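/- Let $0<p<1$ and let $W,J\in\mathbb R$ (thermal noise power and scene power) satisfy $W+pJ>0$. For each $n\ge 1$ let $a^{(n)}_0,\dots,a^{(n)}_{n-1}$ be i.i.d. Bernoulli$(p)$ random variables with values in $\{0,1\}$ (no relation is assumed between different $n$), and let $\mathbf A_n$ be the random $n\times n$ circulant matrix with entries $(\mathbf A_n)_{ji}=a^{(n)}_{(i-j)\bmod n}$. For a scene with covariance matrix $\mathbf Q$ and an aperture of transmissivity $\rho$ with transfer matrix $\mathbf A$, the mutual information of the imaging system is given by $$\mathcal I=\log\det\Big(\frac{1}{W+\rho J}\cdot\frac1n\,\mathbf A\mathbf Q\mathbf A^{T}+\mathbf I\Big).$$ Let $\mathcal I_p$ be its value for the IID scene $\mathbf Q=\mathbf I$, the random on-off aperture $\mathbf A=\mathbf A_n$ and $\rho=p$, and let $\overline{\mathcal I}_p=\mathcal I_p/n$ be the normalized mutual information per pixel. Let $X$ be a real random variable with density $f_X(x)=|x|e^{-x^2}$. Then $\log\big(\frac{p(1-p)}{W+pJ}X^2+1\big)$ is integrable, and, as $n\to\infty$ with $W$, $J$, $p$ fixed, $$\overline{\mathcal I}_p\;\longrightarrow\;\mathbb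 E_X\Big[\log\Big(\frac{p(1-p)}{W+pJ}X^2+1\Big)\Big]\quad\text{in probability.}$$ -/

import Mathlib

open MeasureTheory ProbabilityTheory Filter Topology
open scoped Matrix

noncomputable section

namespace CodedAperture

/-- The circulant transfer matrix of an aperture whose first row is `a`: the entry in row `j`
and column `i` is `a_{(i - j) mod n}` (subtraction in `Fin n` is subtraction modulo `n`). -/
def transferMatrix {n : ℕ} (a : Fin n → ℝ) : Matrix (Fin n) (Fin n) ℝ :=
  Matrix.of fun j i => a (i - j)

/-- The covariance matrix `Q` of the scene in the IID scene model. -/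
def iidSceneCov (n : ℕ) : Matrix (Fin n) (Fin n) ℝ := 1

/-- The mutual information `log det ((1 / (W + ρ J)) (1 / n) A Q Aᵀ + I)` of the imaging system
with transfer matrix `A`, scene covariance `Q`, thermal noise power `W`, scene power `J` and
transmissivity `ρ`. -/
def mutualInfo (W J ρ : ℝ) {n : ℕ} (A Q : Matrix (Fin n) (Fin n) ℝ) : ℝ :=
  Real.log (((1 / (W + ρ * J)) • ((1 / (n : ℝ)) • (A * Q * Aᵀ)) + 1).det)

/-- The mutual information per pixel, `mutualInfo / n`. -/
def normalizedMutualInfo (W J ρ : ℝ) {n : ℕ} (A Q : Matrix (Fin n) (Fin n) ℝ) : ℝ :=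
  mutualInfo W J ρ A Q / n

/-- The law on `ℝ` with density `x ↦ |x| exp (-x²)` with respect to Lebesgue measure. -/
def limitSpectralLaw : Measure ℝ :=
  volume.withDensity fun x => ENNReal.ofReal (|x| * Real.exp (-x ^ 2))

end CodedAperture

end

/-!
The discrete Fourier transform diagonalises the circulant matrix `A`, so the normalized mutual
information is the average over the frequencies `k` of `log (1 + c |λ_k|² / n)`, where
`c = 1 / (W + p J)` and `λ_k = ∑ j, a_j ψ (j k)` (`normalizedMutualInfo_transferMatrix`). Centring
the `a_j` at `p` changes only `λ_0`, and the single term `k = 0` contributes at most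
`log (1 + c n) / n → 0` (`abs_sum_log_sub_centredInfo_le`).

Write `q_k` for the centred value of `|λ_k|² / n`. Frullani's integral
`log (1 + x) = ∫ t > 0, t⁻¹ e⁻ᵗ (1 - e^{-xt})` expresses both the average of `log (1 + c q_k)` and
the limit through Laplace transforms: those of the empirical measure of the `q_k`, and of a multiple
of `X²`, where `X²` is exponentially distributed. It therefore suffices that, for every `s ≥ 0`, the
empirical Laplace transform `(1 / n) ∑ k, e^{-s q_k}` converges in mean to
`L = 1 / (1 + p (1 - p) s)`. Dominated convergence in `t` concludes
(`tendsto_lintegral_enorm_centredInfo_sub`): by Parseval `∑ k, q_k ≤ n`, hence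
`1 - (1 / n) ∑ k, e^{-s q_k} ≤ s`, which cancels the singularity of `t⁻¹` at `0`.

The convergence in mean follows from a second moment bound
(`integral_sq_empiricalLaplace_sub_le`): for all but `O(n)` pairs of frequencies the product
`e^{-s q_k} e^{-s q_l}` has mean close to `L²`. Since `e^{-s y²}` is an average of the characters
`e^{i g y}` over a Gaussian `g`, this mean is a Gaussian average of products of characteristic
functions of the centred Bernoulli law. The second-order expansion of these and the orthogonality of
the trigonometric vectors compare it with the same average for a Gaussian law
(`abs_integral_exp_neg_sub_le`), with an error that does not depend on the pair.
-/

namespace CodedAperture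

/-! ### Frullani's integral and the limit law -/

theorem one_sub_exp_neg_nonneg {x : ℝ} (hx : 0 ≤ x) : 0 ≤ 1 - Real.exp (-x) := by
  have := Real.exp_le_one_iff.2 (neg_nonpos.2 hx)
  linarith

theorem one_sub_exp_neg_le (x : ℝ) : 1 - Real.exp (-x) ≤ x := by
  have := Real.add_one_le_exp (-x)
  linarith

/-- The factor `1 - e^{-xt}` compensates the singularity of `t⁻¹` at `0`. -/
theorem inv_mul_exp_mul_le {x t : ℝ} (ht : 0 < t) :
    t⁻¹ * Real.exp (-t) * (1 - Real.exp (-(x * t))) ≤ x * Real.exp (-t) := by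
  have h := one_sub_exp_neg_le (x * t)
  calc t⁻¹ * Real.exp (-t) * (1 - Real.exp (-(x * t)))
      ≤ t⁻¹ * Real.exp (-t) * (x * t) := by gcongr
    _ = x * Real.exp (-t) := by field_simp

theorem integrableOn_frullani {x : ℝ} (hx : 0 ≤ x) :
    IntegrableOn (fun t => t⁻¹ * Real.exp (-t) * (1 - Real.exp (-(x * t)))) (Set.Ioi 0) := by
  refine Integrable.mono' (g := fun t => x * Real.exp (-t)) ?_ ?_ ?_
  · exact (integrableOn_exp_neg_Ioi 0).const_mul x
  · exact (by fun_prop : Measurable _).aestronglyMeasurable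
  · filter_upwards [ae_restrict_mem measurableSet_Ioi] with t ht
    have ht : 0 < t := ht
    rw [Real.norm_of_nonneg]
    · exact inv_mul_exp_mul_le ht
    · have := one_sub_exp_neg_nonneg (mul_nonneg hx ht.le)
      positivity

theorem log_one_add_eq_integral {x : ℝ} (hx : 0 ≤ x) :
    Real.log (1 + x) =
      ∫ t in Set.Ioi (0 : ℝ), t⁻¹ * Real.exp (-t) * (1 - Real.exp (-(x * t))) := by
  have key : ∀ t : ℝ, t⁻¹ * Real.exp (-t) * (1 - Real.exp (-(x * t)))
      = t⁻¹ • (Real.exp (-(1 * t)) - Real.exp (-((1 + x) * t))) := by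
    intro t
    rw [show -((1 + x) * t) = -t + -(x * t) by ring, Real.exp_add, smul_eq_mul, one_mul]
    ring
  have hint := integrableOn_frullani hx
  simp only [key] at hint ⊢
  rw [Frullani.integral_Ioi_eq (f := fun t => Real.exp (-t)) (L := 1) (R := 0)
    _ one_pos (by linarith) _ _ hint]
  · simp
  · exact (by fun_prop : Continuous fun t : ℝ => Real.exp (-t)).locallyIntegrable.locallyIntegrableOn _
  · have : Tendsto (fun t : ℝ => Real.exp (-t)) (𝓝 0) (𝓝 (Real.exp (-0))) :=
      (by fun_prop : Continuous fun t : ℝ => Real.exp (-t)).tendsto 0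
    simpa using this.mono_left nhdsWithin_le_nhds
  · exact Real.tendsto_exp_neg_atTop_nhds_zero

/-- No integrability of `f` is needed: both sides are `0` when it fails. -/
theorem integral_limitSpectralLaw (f : ℝ → ℝ) :
    ∫ x, f x ∂limitSpectralLaw = ∫ x, |x| * Real.exp (-x ^ 2) * f x := by
  rw [limitSpectralLaw, integral_withDensity_eq_integral_toReal_smul (by fun_prop)
    (Eventually.of_forall fun _ => ENNReal.ofReal_lt_top)]
  refine integral_congr_ae (Eventually.of_forall fun x => ?_)
  simp only [smul_eq_mul]
  rw [ENNReal.toReal_ofReal (by positivity)]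

/-- Under the limit law `X²` is exponentially distributed with parameter `1`. -/
theorem integral_exp_neg_mul_sq_limitSpectralLaw {b : ℝ} (hb : 0 ≤ b) :
    ∫ x, Real.exp (-(b * x ^ 2)) ∂limitSpectralLaw = (1 + b)⁻¹ := by
  rw [integral_limitSpectralLaw]
  have h1 : ∀ x : ℝ, |x| * Real.exp (-x ^ 2) * Real.exp (-(b * x ^ 2))
      = (fun y : ℝ => y ^ (1 : ℝ) * Real.exp (-(1 + b) * y ^ (2 : ℝ))) |x| := by
    intro x
    simp only [Real.rpow_one, Real.rpow_two, sq_abs]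
    rw [mul_assoc, ← Real.exp_add]
    ring_nf
  simp only [h1]
  rw [integral_comp_abs (f := fun y : ℝ => y ^ (1 : ℝ) * Real.exp (-(1 + b) * y ^ (2 : ℝ))),
    integral_rpow_mul_exp_neg_mul_rpow two_pos (by norm_num) (by linarith)]
  norm_num
  rw [Real.rpow_neg_one]
  ring

theorem integrable_sq_limitSpectralLaw : Integrable (fun x : ℝ => x ^ 2) limitSpectralLaw := by
  rw [limitSpectralLaw, integrable_withDensity_iff (by fun_prop)
    (Eventually.of_forall fun _ => ENNReal.ofReal_lt_top)]
  have h : Integrable (fun x : ℝ => x ^ (3 : ℕ) * Real.exp (-1 * x ^ 2)) := by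
    simpa only [Real.rpow_ofNat] using
      integrable_rpow_mul_exp_neg_mul_sq (b := 1) one_pos (s := 3) (by norm_num)
  refine h.norm.congr (Eventually.of_forall fun x => ?_)
  simp only [norm_mul, Real.norm_eq_abs, Real.abs_exp]
  rw [ENNReal.toReal_ofReal (by positivity), abs_pow, ← sq_abs x]
  ring_nf

theorem integrable_log_limitSpectralLaw {b : ℝ} (hb : 0 ≤ b) :
    Integrable (fun x : ℝ => Real.log (1 + b * x ^ 2)) limitSpectralLaw := by
  refine (integrable_sq_limitSpectralLaw.const_mul b).mono'
    (by fun_prop : Measurable _).aestronglyMeasurable (Eventually.of_forall fun x => ?_)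
  have h : 0 ≤ b * x ^ 2 := by positivity
  rw [Real.norm_of_nonneg (Real.log_nonneg (by linarith))]
  have := Real.log_le_sub_one_of_pos (show 0 < 1 + b * x ^ 2 by linarith)
  linarith

theorem integral_log_limitSpectralLaw [IsProbabilityMeasure limitSpectralLaw]
    {b : ℝ} (hb : 0 ≤ b) :
    ∫ x, Real.log (1 + b * x ^ 2) ∂limitSpectralLaw
      = ∫ t in Set.Ioi (0 : ℝ), t⁻¹ * Real.exp (-t) * (1 - (1 + b * t)⁻¹) := by
  have h1 : ∀ x : ℝ, Real.log (1 + b * x ^ 2) = ∫ t in Set.Ioi (0 : ℝ),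
      t⁻¹ * Real.exp (-t) * (1 - Real.exp (-(b * x ^ 2 * t))) :=
    fun x => log_one_add_eq_integral (by positivity)
  simp only [h1]
  rw [integral_integral_swap]
  · refine setIntegral_congr_fun measurableSet_Ioi fun t ht => ?_
    have ht : 0 < t := ht
    have hexp : Integrable (fun x : ℝ => Real.exp (-(b * x ^ 2 * t))) limitSpectralLaw := by
      refine (integrable_const (1 : ℝ)).mono' (by fun_prop : Measurable _).aestronglyMeasurable
        (Eventually.of_forall fun x => ?_)
      rw [Real.norm_of_nonneg (Real.exp_nonneg _), Real.exp_le_one_iff]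
      have : 0 ≤ b * x ^ 2 * t := by positivity
      linarith
    have h2 := integral_exp_neg_mul_sq_limitSpectralLaw (b := b * t) (by positivity)
    simp only [mul_right_comm b _ t] at hexp ⊢
    rw [integral_const_mul, integral_sub (integrable_const _) hexp, h2]
    simp
  · refine Integrable.mono' (g := fun z : ℝ × ℝ => (b * z.1 ^ 2) * Real.exp (-z.2)) ?_
      (by unfold Function.uncurry; fun_prop : Measurable _).aestronglyMeasurable ?_
    · exact (integrable_sq_limitSpectralLaw.const_mul b).mul_prod (integrableOn_exp_neg_Ioi 0)
    · have hmem : ∀ᵐ z : ℝ × ℝ ∂(limitSpectralLaw.prod (volume.restrict (Set.Ioi 0))),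
          0 < z.2 :=
        Measure.quasiMeasurePreserving_snd.ae (ae_restrict_mem measurableSet_Ioi)
      filter_upwards [hmem] with z hz
      simp only [Function.uncurry]
      rw [Real.norm_of_nonneg]
      · exact inv_mul_exp_mul_le hz
      · have := one_sub_exp_neg_nonneg (show 0 ≤ b * z.1 ^ 2 * z.2 by positivity)
        positivity

/-! ### Circulant matrices and the discrete Fourier transform -/

theorem norm_stdAddChar {N : ℕ} [NeZero N] (x : ZMod N) : ‖ZMod.stdAddChar x‖ = 1 := by
  rw [ZMod.stdAddChar_apply, Circle.norm_coe]

theorem conj_stdAddChar {N : ℕ} [NeZero N] (x : ZMod N) :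
    (starRingEnd ℂ) (ZMod.stdAddChar x) = ZMod.stdAddChar (-x) :=
  (AddChar.map_neg_eq_conj _ _).symm

theorem sum_stdAddChar_mul {N : ℕ} [NeZero N] (b : ZMod N) :
    ∑ x : ZMod N, ZMod.stdAddChar (x * b) = if b = 0 then (N : ℂ) else 0 := by
  rw [AddChar.sum_mulShift b (ZMod.isPrimitive_stdAddChar N), ZMod.card]
  split_ifs <;> simp

/-- The Fourier coefficient `∑ j, y j * ψ (j k)` of a real vector at the frequency `k`, where `ψ` is
the standard additive character of `ZMod N`; there is no normalisation. -/
noncomputable def dftCoeff {N : ℕ} [NeZero N] (y : ZMod N → ℝ) (k : ZMod N) : ℂ :=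
  ∑ j, (y j : ℂ) * ZMod.stdAddChar (j * k)

/-- The matrix of the discrete Fourier transform, unnormalised: its entries are `ψ (i k)`. -/
noncomputable def dftMatrix (N : ℕ) [NeZero N] : Matrix (ZMod N) (ZMod N) ℂ :=
  Matrix.of fun i k => ZMod.stdAddChar (i * k)

theorem det_dftMatrix_ne_zero (N : ℕ) [NeZero N] : (dftMatrix N).det ≠ 0 := by
  have h : dftMatrix N * (Matrix.of fun k i => ZMod.stdAddChar (-(i * k))) = (N : ℂ) • 1 := by
    ext i j
    simp only [dftMatrix, Matrix.mul_apply, Matrix.of_apply, ← AddChar.map_add_eq_mul,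
      Matrix.smul_apply, Matrix.one_apply]
    have : ∀ k : ZMod N, i * k + -(j * k) = k * (i - j) := fun k => by ring
    simp only [this, sum_stdAddChar_mul, sub_eq_zero]
    split_ifs <;> simp
  intro h0
  have h1 := congrArg Matrix.det h
  rw [Matrix.det_mul, h0, zero_mul, Matrix.det_smul, Matrix.det_one, mul_one] at h1
  exact pow_ne_zero _ (Nat.cast_ne_zero.2 (NeZero.ne N)) h1.symm

/-- The columns of the DFT matrix are eigenvectors of a circulant matrix. -/
theorem circulant_mul_dftMatrix {N : ℕ} [NeZero N] (a : ZMod N → ℝ) :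
    (Matrix.of fun j i => (a (i - j) : ℂ)) * dftMatrix N
      = dftMatrix N * Matrix.diagonal (dftCoeff a) := by
  ext j k
  rw [Matrix.mul_diagonal]
  simp only [Matrix.mul_apply, Matrix.of_apply, dftMatrix, dftCoeff, Finset.mul_sum]
  rw [← Equiv.sum_comp (Equiv.addRight j)]
  refine Finset.sum_congr rfl fun i _ => ?_
  simp only [Equiv.coe_addRight, add_sub_cancel_right, add_mul, AddChar.map_add_eq_mul]
  ring

theorem circulant_transpose_mul_dftMatrix {N : ℕ} [NeZero N] (a : ZMod N → ℝ) :
    (Matrix.of fun j i => (a (j - i) : ℂ)) * dftMatrix N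
      = dftMatrix N * Matrix.diagonal (fun k => (starRingEnd ℂ) (dftCoeff a k)) := by
  ext j k
  rw [Matrix.mul_diagonal]
  simp only [Matrix.mul_apply, Matrix.of_apply, dftMatrix, dftCoeff, Finset.mul_sum, map_sum,
    map_mul, Complex.conj_ofReal, conj_stdAddChar]
  rw [← Equiv.sum_comp (Equiv.subLeft j)]
  refine Finset.sum_congr rfl fun i _ => ?_
  simp only [Equiv.subLeft_apply, sub_sub_cancel]
  rw [show (j - i) * k = j * k + -(i * k) by ring, AddChar.map_add_eq_mul]
  ring

theorem det_smul_circulant_mul_transpose_add_one {N : ℕ} [NeZero N] (a : ZMod N → ℝ) (c : ℝ) :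
    (c • ((Matrix.of fun j i => a (i - j)) * (Matrix.of fun j i => a (i - j))ᵀ)
      + (1 : Matrix (ZMod N) (ZMod N) ℝ)).det = ∏ k, (1 + c * ‖dftCoeff a k‖ ^ 2) := by
  set M := c • ((Matrix.of fun j i => a (i - j)) * (Matrix.of fun j i => a (i - j))ᵀ)
      + (1 : Matrix (ZMod N) (ZMod N) ℝ) with hM
  have hmap : M.map ((↑) : ℝ → ℂ) = (c : ℂ) • ((Matrix.of fun j i => (a (i - j) : ℂ)) *
      (Matrix.of fun j i => (a (j - i) : ℂ))) + 1 := by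
    ext i j
    simp [hM, Matrix.mul_apply, Matrix.one_apply, apply_ite ((↑) : ℝ → ℂ)]
  have hmul : M.map ((↑) : ℝ → ℂ) * dftMatrix N
      = dftMatrix N * Matrix.diagonal (fun k => ((1 + c * ‖dftCoeff a k‖ ^ 2 : ℝ) : ℂ)) := by
    rw [hmap, add_mul, Matrix.smul_mul, Matrix.mul_assoc, circulant_transpose_mul_dftMatrix,
      ← Matrix.mul_assoc, circulant_mul_dftMatrix, Matrix.mul_assoc, Matrix.diagonal_mul_diagonal,
      one_mul]
    ext i k
    rw [Matrix.add_apply, Matrix.smul_apply, Matrix.mul_diagonal, Matrix.mul_diagonal,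
      Complex.mul_conj, Complex.normSq_eq_norm_sq, smul_eq_mul]
    push_cast
    ring
  have hdet := congrArg Matrix.det hmul
  rw [Matrix.det_mul, Matrix.det_mul, mul_comm, Matrix.det_diagonal] at hdet
  have h2 := mul_left_cancel₀ (det_dftMatrix_ne_zero N) hdet
  have h3 : (M.map ((↑) : ℝ → ℂ)).det = ((M.det : ℝ) : ℂ) :=
    (RingHom.map_det Complex.ofRealHom M).symm
  rw [h3] at h2
  exact_mod_cast h2

/-- **Parseval's identity** on `ZMod N`. -/
theorem sum_norm_dftCoeff_sq {N : ℕ} [NeZero N] (y : ZMod N → ℝ) :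
    ∑ k, ‖dftCoeff y k‖ ^ 2 = N * ∑ j, y j ^ 2 := by
  have h : ∑ k, dftCoeff y k * (starRingEnd ℂ) (dftCoeff y k) = N * ∑ j, (y j : ℂ) ^ 2 := by
    simp only [dftCoeff, map_sum, map_mul, Complex.conj_ofReal, conj_stdAddChar,
      Finset.sum_mul_sum]
    rw [Finset.sum_comm, Finset.mul_sum]
    refine Finset.sum_congr rfl fun j _ => ?_
    rw [Finset.sum_comm]
    have : ∀ i : ZMod N, ∑ k : ZMod N, (y j : ℂ) * ZMod.stdAddChar (j * k) *
        (y i * ZMod.stdAddChar (-(i * k))) = if i = j then N * (y j : ℂ) ^ 2 else 0 := by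
      intro i
      have h1 : ∀ k : ZMod N, (y j : ℂ) * ZMod.stdAddChar (j * k) *
        (y i * ZMod.stdAddChar (-(i * k))) = y j * y i * ZMod.stdAddChar (k * (j - i)) := by
        intro k
        rw [show k * (j - i) = j * k + -(i * k) by ring, AddChar.map_add_eq_mul]
        ring
      simp only [h1, ← Finset.mul_sum, sum_stdAddChar_mul, sub_eq_zero, eq_comm (a := j)]
      split_ifs with hij
      · subst hij; ring
      · simp
    simp [this]
  simp only [Complex.mul_conj, Complex.normSq_eq_norm_sq] at h
  exact_mod_cast h

/-- The vectors `j ↦ Re ψ (j kₘ)` and `j ↦ Im ψ (j kₘ)` are pairwise orthogonal with squared norm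
`N / 2`, provided that the frequencies `kₘ` are distinct and no two of them, equal ones included, are
opposite. -/
theorem sum_sq_trig_eq {N : ℕ} [NeZero N] {ι : Type*} [Fintype ι] (k : ι → ZMod N)
    (hk : Function.Injective k) (hk' : ∀ m m', k m + k m' ≠ 0) (u v : ι → ℝ) :
    ∑ j : ZMod N, (∑ m, (u m * (ZMod.stdAddChar (j * k m)).re
      + v m * (ZMod.stdAddChar (j * k m)).im)) ^ 2 = N / 2 * ∑ m, (u m ^ 2 + v m ^ 2) := by
  classical
  let Θ : ι → ℂ := fun m => ⟨u m, -v m⟩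
  let w : ZMod N → ℂ := fun j => ∑ m, Θ m * ZMod.stdAddChar (j * k m)
  have hre : ∀ j, ∑ m, (u m * (ZMod.stdAddChar (j * k m)).re
      + v m * (ZMod.stdAddChar (j * k m)).im) = (w j).re := by
    intro j
    simp [w, Θ, Complex.re_sum]
  have h1 : ∑ j, w j ^ 2 = 0 := by
    simp only [w, pow_two, Finset.sum_mul_sum]
    rw [Finset.sum_comm]
    refine Finset.sum_eq_zero fun m _ => ?_
    rw [Finset.sum_comm]
    refine Finset.sum_eq_zero fun m' _ => ?_
    have : ∀ j : ZMod N, Θ m * ZMod.stdAddChar (j * k m) * (Θ m' * ZMod.stdAddChar (j * k m'))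
        = Θ m * Θ m' * ZMod.stdAddChar (j * (k m + k m')) := by
      intro j
      rw [mul_add, AddChar.map_add_eq_mul]; ring
    simp only [this, ← Finset.mul_sum, sum_stdAddChar_mul, if_neg (hk' m m'), mul_zero]
  have h2 : ∑ j, w j * (starRingEnd ℂ) (w j) = ((N * ∑ m, (u m ^ 2 + v m ^ 2) : ℝ) : ℂ) := by
    simp only [w, map_sum, map_mul, conj_stdAddChar, Finset.sum_mul_sum]
    rw [Finset.sum_comm]
    push_cast
    rw [Finset.mul_sum]
    refine Finset.sum_congr rfl fun m _ => ?_
    rw [Finset.sum_comm]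
    have : ∀ m' : ι, ∑ j : ZMod N, Θ m * ZMod.stdAddChar (j * k m) *
        ((starRingEnd ℂ) (Θ m') * ZMod.stdAddChar (-(j * k m')))
        = if m' = m then N * (Θ m * (starRingEnd ℂ) (Θ m)) else 0 := by
      intro m'
      have h3 : ∀ j : ZMod N, Θ m * ZMod.stdAddChar (j * k m) *
          ((starRingEnd ℂ) (Θ m') * ZMod.stdAddChar (-(j * k m')))
          = Θ m * (starRingEnd ℂ) (Θ m') * ZMod.stdAddChar (j * (k m - k m')) := by
        intro j
        rw [show j * (k m - k m') = j * k m + -(j * k m') by ring, AddChar.map_add_eq_mul]; ring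
      simp only [h3, ← Finset.mul_sum, sum_stdAddChar_mul, sub_eq_zero, hk.eq_iff,
        eq_comm (a := m)]
      split_ifs with hij
      · subst hij; ring
      · simp
    simp only [this, Finset.sum_ite_eq', Finset.mem_univ, if_true]
    rw [Complex.mul_conj, Complex.normSq_apply]
    simp [Θ, pow_two]
  -- The orthogonality relations for `ψ` evaluate the sums of `|w j|²` and of `(w j)²`.
  have h3 : ∀ z : ℂ, z.re ^ 2 = ((z * (starRingEnd ℂ) z).re + (z ^ 2).re) / 2 := by
    intro z
    simp [pow_two]
  simp only [hre, h3]
  rw [← Finset.sum_div, Finset.sum_add_distrib, ← Complex.re_sum, ← Complex.re_sum, h1, h2]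
  simp only [Complex.ofReal_re, Complex.zero_re]
  ring

/-- A pair of frequencies whose real and imaginary characters form four orthogonal vectors. -/
def GenericPair {N : ℕ} (k l : ZMod N) : Prop :=
  k + k ≠ 0 ∧ l + l ≠ 0 ∧ k + l ≠ 0 ∧ k ≠ l

open Classical in
theorem card_not_genericPair_le (N : ℕ) [NeZero N] :
    (Finset.univ.filter fun z : ZMod N × ZMod N => ¬ GenericPair z.1 z.2).card ≤ 6 * N := by
  set A : Finset (ZMod N) := Finset.univ.filter fun k => 2 • k = 0 with hA
  have hA2 : A.card ≤ 2 := IsAddCyclic.card_nsmul_eq_zero_le two_pos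
  have hsub : (Finset.univ.filter fun z : ZMod N × ZMod N => ¬ GenericPair z.1 z.2) ⊆
      (A ×ˢ Finset.univ ∪ Finset.univ ×ˢ A) ∪
      (Finset.univ.image (fun k : ZMod N => (k, -k)) ∪
        Finset.univ.image (fun k : ZMod N => (k, k))) := by
    rintro ⟨k, l⟩ h
    have h := (Finset.mem_filter.1 h).2
    simp only [hA, Finset.mem_union, Finset.mem_product, Finset.mem_filter, Finset.mem_univ,
      true_and, and_true, Finset.mem_image, Prod.mk.injEq, two_nsmul, exists_eq_left]
    by_contra! hcon
    refine h ⟨hcon.1.1, hcon.1.2, fun h0 => hcon.2.1 (neg_eq_of_add_eq_zero_right h0), hcon.2.2⟩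
  refine (Finset.card_le_card hsub).trans ?_
  refine (Finset.card_union_le _ _).trans ?_
  have h1 := Finset.card_union_le (A ×ˢ (Finset.univ : Finset (ZMod N))) (Finset.univ ×ˢ A)
  have h2 := Finset.card_union_le (Finset.univ.image (fun k : ZMod N => (k, -k)))
    (Finset.univ.image (fun k : ZMod N => (k, k)))
  have h3 := Finset.card_image_le (s := Finset.univ) (f := fun k : ZMod N => (k, -k))
  have h4 := Finset.card_image_le (s := Finset.univ) (f := fun k : ZMod N => (k, k))
  rw [Finset.card_product, Finset.card_product] at h1
  simp only [Finset.card_univ, ZMod.card] at h1 h3 h4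
  nlinarith

/-! ### Gaussian linearisation and the central limit estimate -/

theorem norm_prod_sub_prod_le {J : Type*} (s : Finset J) (a b : J → ℂ)
    (ha : ∀ j ∈ s, ‖a j‖ ≤ 1) (hb : ∀ j ∈ s, ‖b j‖ ≤ 1) :
    ‖∏ j ∈ s, a j - ∏ j ∈ s, b j‖ ≤ ∑ j ∈ s, ‖a j - b j‖ := by
  classical
  induction s using Finset.induction_on with
  | empty => simp
  | insert i s hi ih =>
    rw [Finset.prod_insert hi, Finset.prod_insert hi, Finset.sum_insert hi]
    have h1 : ‖∏ j ∈ s, a j‖ ≤ 1 := by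
      rw [norm_prod]
      exact Finset.prod_le_one (fun _ _ => norm_nonneg _)
        fun j hj => ha j (Finset.mem_insert_of_mem hj)
    have h2 := hb i (Finset.mem_insert_self i s)
    have h3 := ih (fun j hj => ha j (Finset.mem_insert_of_mem hj))
      (fun j hj => hb j (Finset.mem_insert_of_mem hj))
    calc ‖a i * ∏ j ∈ s, a j - b i * ∏ j ∈ s, b j‖
        = ‖(a i - b i) * ∏ j ∈ s, a j + b i * (∏ j ∈ s, a j - ∏ j ∈ s, b j)‖ := by
          congr 1; ring
      _ ≤ ‖a i - b i‖ * ‖∏ j ∈ s, a j‖ + ‖b i‖ * ‖∏ j ∈ s, a j - ∏ j ∈ s, b j‖ := by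
          rw [← norm_mul, ← norm_mul]; exact norm_add_le _ _
      _ ≤ ‖a i - b i‖ * 1 + 1 * ∑ j ∈ s, ‖a j - b j‖ := by gcongr
      _ = _ := by ring

theorem norm_cexp_mul_I_sub_le {y : ℝ} (hy : |y| ≤ 1) :
    ‖Complex.exp (y * Complex.I) - (1 + y * Complex.I - y ^ 2 / 2)‖ ≤ |y| ^ 3 := by
  have hn : ‖(y : ℂ) * Complex.I‖ = |y| := by simp
  have h := Complex.exp_bound (x := y * Complex.I) (by rw [hn]; exact hy) (n := 3) (by norm_num)
  rw [hn] at h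
  simp only [Finset.sum_range_succ, Finset.sum_range_zero, mul_pow, Complex.I_sq] at h
  norm_num [Nat.factorial] at h
  have h0 : 0 ≤ |y| ^ 3 := by positivity
  calc _ = ‖Complex.exp (y * Complex.I) - (1 + y * Complex.I + -(y : ℂ) ^ 2 / 2)‖ := by
        congr 1; ring
    _ ≤ |y| ^ 3 * (2 / 9) := h
    _ ≤ |y| ^ 3 := by linarith

/-- The characteristic function of the centred Bernoulli law agrees with that of the Gaussian law of
variance `p (1 - p)` up to a cubic error. -/
theorem norm_integral_cexp_bernoulli_sub_le (p : unitInterval) (u : ℝ) :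
    ‖(∫ x : ℝ, Complex.exp ((u * (x - p) : ℝ) * Complex.I) ∂bernoulliMeasure (1 : ℝ) 0 p)
      - Complex.exp ((-(p * (1 - p) / 2 * u ^ 2) : ℝ))‖ ≤ 2 * |u| ^ 3 := by
  have hp0 : (0 : ℝ) ≤ p := p.2.1
  have hp1 : (p : ℝ) ≤ 1 := p.2.2
  have hv : (0 : ℝ) ≤ p * (1 - p) := mul_nonneg hp0 (by linarith)
  have hv1 : (p : ℝ) * (1 - p) ≤ 1 := by nlinarith
  rcases le_or_gt 1 |u| with hu | hu
  · have h1 : ‖∫ x : ℝ, Complex.exp ((u * (x - p) : ℝ) * Complex.I)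
        ∂bernoulliMeasure (1 : ℝ) 0 p‖ ≤ 1 := by
      refine (norm_integral_le_integral_norm _).trans ?_
      simp only [Complex.norm_exp_ofReal_mul_I]
      simp
    have h2 : ‖Complex.exp ((-(p * (1 - p) / 2 * u ^ 2) : ℝ))‖ ≤ 1 := by
      rw [Complex.norm_exp_ofReal, Real.exp_le_one_iff]
      have : 0 ≤ (p : ℝ) * (1 - p) / 2 * u ^ 2 := by positivity
      linarith
    have h3 : (1 : ℝ) ≤ |u| ^ 3 := one_le_pow₀ hu
    exact (norm_sub_le _ _).trans (by linarith)
  · have hA := norm_cexp_mul_I_sub_le (y := u * (1 - p)) (by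
      rw [abs_mul, abs_of_nonneg (sub_nonneg.2 hp1)]
      exact mul_le_one₀ hu.le (by linarith) (by linarith))
    have hB := norm_cexp_mul_I_sub_le (y := u * (0 - p)) (by
      rw [abs_mul, zero_sub, abs_neg, abs_of_nonneg hp0]
      exact mul_le_one₀ hu.le hp0 hp1)
    have hA' : |u * (1 - p)| ^ 3 ≤ |u| ^ 3 := by
      refine pow_le_pow_left₀ (abs_nonneg _) ?_ 3
      rw [abs_mul, abs_of_nonneg (sub_nonneg.2 hp1)]
      exact mul_le_of_le_one_right (abs_nonneg _) (by linarith)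
    have hB' : |u * (0 - p)| ^ 3 ≤ |u| ^ 3 := by
      refine pow_le_pow_left₀ (abs_nonneg _) ?_ 3
      rw [abs_mul, zero_sub, abs_neg, abs_of_nonneg hp0]
      exact mul_le_of_le_one_right (abs_nonneg _) hp1
    have hyn : |-((p : ℝ) * (1 - p) / 2 * u ^ 2)| ≤ |u| ^ 2 := by
      rw [abs_neg, abs_of_nonneg (by positivity), sq_abs]
      have := sq_nonneg u
      nlinarith
    have hC := Real.abs_exp_sub_one_sub_id_le (x := -(p * (1 - p) / 2 * u ^ 2))
      (hyn.trans (pow_le_one₀ (abs_nonneg _) hu.le))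
    rw [← sq_abs (-((p : ℝ) * (1 - p) / 2 * u ^ 2))] at hC
    have hC' : |-((p : ℝ) * (1 - p) / 2 * u ^ 2)| ^ 2 ≤ |u| ^ 3 := by
      calc _ ≤ (|u| ^ 2) ^ 2 := by gcongr
        _ = |u| ^ 3 * |u| := by ring
        _ ≤ |u| ^ 3 := mul_le_of_le_one_right (by positivity) hu.le
    have hC2 : ‖Complex.exp ((-(p * (1 - p) / 2 * u ^ 2) : ℝ))
        - (1 - p * (1 - p) / 2 * u ^ 2)‖ ≤ |u| ^ 3 := by
      rw [← Complex.ofReal_exp]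
      have : ((1 : ℂ) - p * (1 - p) / 2 * u ^ 2) = ((1 - p * (1 - p) / 2 * u ^ 2 : ℝ) : ℂ) := by
        push_cast; ring
      rw [this, ← Complex.ofReal_sub, Complex.norm_real, Real.norm_eq_abs]
      refine le_trans (le_of_eq ?_) (hC.trans hC')
      congr 1
      ring
    rw [integral_bernoulliMeasure]
    set EA := Complex.exp ((u * (1 - p) : ℝ) * Complex.I)
    set EB := Complex.exp ((u * (0 - p) : ℝ) * Complex.I)
    set EC := Complex.exp ((-(p * (1 - p) / 2 * u ^ 2) : ℝ))
    -- The first moment of the centred variable vanishes and the second one is `p (1 - p)`.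
    have hsplit : (p : ℝ) • EA + (1 - p : ℝ) • EB - EC
        = (p : ℝ) • (EA - (1 + (u * (1 - p) : ℝ) * Complex.I - (u * (1 - p) : ℝ) ^ 2 / 2))
        + (1 - p : ℝ) • (EB - (1 + (u * (0 - p) : ℝ) * Complex.I - (u * (0 - p) : ℝ) ^ 2 / 2))
        - (EC - (1 - p * (1 - p) / 2 * u ^ 2)) := by
      simp only [Complex.real_smul]
      push_cast
      ring
    rw [hsplit]
    refine (norm_sub_le _ _).trans ?_
    have h1 := norm_add_le
      ((p : ℝ) • (EA - (1 + (u * (1 - p) : ℝ) * Complex.I - (u * (1 - p) : ℝ) ^ 2 / 2)))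
      ((1 - p : ℝ) • (EB - (1 + (u * (0 - p) : ℝ) * Complex.I - (u * (0 - p) : ℝ) ^ 2 / 2)))
    rw [norm_smul, norm_smul, Real.norm_of_nonneg hp0, Real.norm_of_nonneg (sub_nonneg.2 hp1)] at h1
    have h2 := mul_le_mul_of_nonneg_left (hA.trans hA') hp0
    have h3 := mul_le_mul_of_nonneg_left (hB.trans hB') (sub_nonneg.2 hp1)
    linarith

/-- The error in the comparison with the Gaussian law, as an average over the auxiliary Gaussian
vector of variance `w`. The truncation at `2` makes dominated convergence in `n` immediate. -/
noncomputable def cltError (ι : Type*) [Fintype ι] (w : NNReal) (n : ℕ) : ℝ :=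
  ∫ g : ι → ℝ, min 2 (2 * (∑ m, |g m|) ^ 3 / √n) ∂Measure.pi fun _ => gaussianReal 0 w

theorem tendsto_cltError (ι : Type*) [Fintype ι] (w : NNReal) :
    Tendsto (cltError ι w) atTop (𝓝 0) := by
  have h := tendsto_integral_of_dominated_convergence
    (μ := Measure.pi fun _ : ι => gaussianReal 0 w)
    (F := fun (n : ℕ) (g : ι → ℝ) => min 2 (2 * (∑ m, |g m|) ^ 3 / √(n : ℝ)))
    (f := fun _ => (0 : ℝ)) (fun _ => 2)
    (fun n => (by fun_prop : Measurable _).aestronglyMeasurable) (integrable_const _) ?_ ?_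
  · rw [integral_zero] at h
    exact h
  · intro n
    refine Eventually.of_forall fun g => ?_
    rw [Real.norm_of_nonneg (by positivity)]
    exact min_le_left _ _
  · refine Eventually.of_forall fun g => ?_
    have h1 : Tendsto (fun n : ℕ => 2 * (∑ m, |g m|) ^ 3 / √(n : ℝ)) atTop (𝓝 0) :=
      tendsto_const_nhds.div_atTop (Real.tendsto_sqrt_atTop.comp tendsto_natCast_atTop_atTop)
    simpa using (tendsto_const_nhds (x := (2 : ℝ))).min h1

/-- Gaussian linearisation: `e^{-w |Y|² / 2}` as an average of the characters `e^{i ⟨Y, g⟩}`. -/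
theorem exp_neg_sum_sq_eq_integral {ι : Type*} [Fintype ι] (w : NNReal) (Y : ι → ℝ) :
    ((Real.exp (-(w / 2 * ∑ m, Y m ^ 2)) : ℝ) : ℂ)
      = ∫ g : ι → ℝ, Complex.exp ((∑ m, Y m * g m : ℝ) * Complex.I)
          ∂Measure.pi fun _ => gaussianReal 0 w := by
  have h1 : ∀ g : ι → ℝ, Complex.exp ((∑ m, Y m * g m : ℝ) * Complex.I)
      = ∏ m, Complex.exp (Y m * g m * Complex.I) := by
    intro g
    rw [← Complex.exp_sum, ← Finset.sum_mul]
    push_cast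
    rfl
  simp only [h1]
  rw [integral_fintype_prod_eq_prod (fun m (x : ℝ) => Complex.exp (Y m * x * Complex.I))]
  simp only [← charFun_apply_real, charFun_gaussianReal]
  rw [← Complex.exp_sum]
  push_cast
  congr 1
  rw [Finset.mul_sum, ← Finset.sum_neg_distrib]
  refine Finset.sum_congr rfl fun m _ => ?_
  ring

/-- The integral is squared because a frequency contributes two real coordinates; this also removes
the square root from the value. -/
theorem integral_exp_neg_mul_sq_gaussianReal_sq (w : NNReal) {b : ℝ} (hb : 0 ≤ b) :
    (∫ g, Real.exp (-(b / 2 * g ^ 2)) ∂gaussianReal 0 w) ^ 2 = (1 + b * w)⁻¹ := by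
  rcases eq_or_ne w 0 with rfl | hw
  · simp
  have hw' : (0 : ℝ) < w := by positivity
  rw [integral_gaussianReal_eq_integral_smul hw]
  simp only [gaussianPDFReal_def, smul_eq_mul, mul_assoc, ← Real.exp_add]
  have : ∀ x : ℝ, -(x - 0) ^ 2 / (2 * w) + -(b / 2 * x ^ 2) = -((1 + b * w) / (2 * w)) * x ^ 2 := by
    intro x; field_simp; ring
  simp only [this]
  have h1 : 0 < 1 + b * w := by positivity
  rw [integral_const_mul, integral_gaussian, mul_pow, inv_pow, Real.sq_sqrt (by positivity),
    Real.sq_sqrt (by positivity)]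
  field_simp

/-- A quantitative central limit theorem for `|ι|` linear forms in i.i.d. centred Bernoulli variables
whose coefficient vectors are orthogonal, tested against `e^{-w |y|² / 2}`. The bound depends on the
forms only through their number. -/
theorem abs_integral_exp_neg_sub_le {J ι : Type*} [Fintype J] [Nonempty J] [Fintype ι]
    (p : unitInterval) (w : NNReal) (c : ι → J → ℝ) (hc : ∀ m j, |c m j| ≤ 1)
    (horth : ∀ g : ι → ℝ, ∑ j, (∑ m, g m * c m j) ^ 2 = Fintype.card J / 2 * ∑ m, g m ^ 2) :
    |(∫ x : J → ℝ, Real.exp (-(w / 2 * ∑ m, (∑ j, (x j - p) * c m j) ^ 2 / Fintype.card J))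
        ∂Measure.pi fun _ => bernoulliMeasure (1 : ℝ) 0 p)
      - (∫ g, Real.exp (-(p * (1 - p) / 2 / 2 * g ^ 2)) ∂gaussianReal 0 w) ^ Fintype.card ι|
      ≤ cltError ι w (Fintype.card J) := by
  set N : ℝ := (Fintype.card J : ℝ) with hN
  have hNpos : 0 < N := by rw [hN]; exact_mod_cast Fintype.card_pos
  set ν := bernoulliMeasure (1 : ℝ) 0 p
  set γ := Measure.pi fun _ : ι => gaussianReal 0 w
  set σ2 : ℝ := p * (1 - p) with hσ
  have hσ0 : 0 ≤ σ2 := mul_nonneg p.2.1 (sub_nonneg.2 p.2.2)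
  let u : (ι → ℝ) → J → ℝ := fun g j => (∑ m, g m * c m j) / √N
  have hsqrt : √N ^ 2 = N := Real.sq_sqrt hNpos.le
  have hsp : 0 < √N := Real.sqrt_pos.2 hNpos
  -- Linearise, exchange the two expectations, and use independence of the coordinates of `x`.
  have hleft : ((∫ x : J → ℝ, Real.exp (-(w / 2 * ∑ m, (∑ j, (x j - p) * c m j) ^ 2 / N))
        ∂Measure.pi fun _ => ν : ℝ) : ℂ)
      = ∫ g, ∏ j, ∫ x : ℝ, Complex.exp ((u g j * (x - p) : ℝ) * Complex.I) ∂ν ∂γ := by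
    rw [← integral_complex_ofReal]
    have h1 : ∀ x : J → ℝ,
        ((Real.exp (-(w / 2 * ∑ m, (∑ j, (x j - p) * c m j) ^ 2 / N)) : ℝ) : ℂ)
        = ∫ g : ι → ℝ, Complex.exp ((∑ j, u g j * (x j - p) : ℝ) * Complex.I) ∂γ := by
      intro x
      have h2 := exp_neg_sum_sq_eq_integral w (fun m => (∑ j, (x j - p) * c m j) / √N)
      simp only [div_pow, hsqrt] at h2
      rw [h2]
      refine integral_congr_ae (Eventually.of_forall fun g => ?_)
      simp only [u]
      congr 3
      simp only [div_mul_eq_mul_div, Finset.sum_mul, ← Finset.sum_div]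
      rw [Finset.sum_comm]
      congr 1
      refine Finset.sum_congr rfl fun j _ => Finset.sum_congr rfl fun m _ => ?_
      ring
    simp only [h1]
    rw [integral_integral_swap]
    · refine integral_congr_ae (Eventually.of_forall fun g => ?_)
      simp only []
      rw [← integral_fintype_prod_eq_prod
        (fun j (x : ℝ) => Complex.exp ((u g j * (x - p) : ℝ) * Complex.I))]
      refine integral_congr_ae (Eventually.of_forall fun x => ?_)
      simp only []
      rw [← Complex.exp_sum, ← Finset.sum_mul]
      push_cast
      rfl
    · refine (integrable_const (1 : ℝ)).mono'
        (by unfold Function.uncurry; fun_prop : Measurable _).aestronglyMeasurable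
        (Eventually.of_forall fun z => ?_)
      simp only [Function.uncurry, Complex.norm_exp_ofReal_mul_I, le_refl]
  -- By orthogonality the Gaussian characteristic functions multiply to a function of `∑ g m ^ 2`.
  have hright : (((∫ g, Real.exp (-(σ2 / 2 / 2 * g ^ 2)) ∂gaussianReal 0 w) ^ Fintype.card ι : ℝ) : ℂ)
      = ∫ g, ∏ j, Complex.exp ((-(σ2 / 2 * u g j ^ 2) : ℝ)) ∂γ := by
    rw [← integral_fintype_prod_eq_pow, ← integral_complex_ofReal]
    refine integral_congr_ae (Eventually.of_forall fun g => ?_)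
    simp only [← Complex.ofReal_exp, ← Complex.ofReal_prod, ← Real.exp_sum]
    congr 2
    rw [Finset.sum_neg_distrib, Finset.sum_neg_distrib, ← Finset.mul_sum, ← Finset.mul_sum]
    simp only [u, div_pow, hsqrt, ← Finset.sum_div, horth g]
    field_simp
  have hmeas1 : Measurable fun g : ι → ℝ =>
      ∏ j, ∫ x : ℝ, Complex.exp ((u g j * (x - p) : ℝ) * Complex.I) ∂ν := by
    simp only [ν, integral_bernoulliMeasure]
    fun_prop
  have hn1 : ∀ g j, ‖∫ x : ℝ, Complex.exp ((u g j * (x - p) : ℝ) * Complex.I) ∂ν‖ ≤ 1 := by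
    intro g j
    refine (norm_integral_le_integral_norm _).trans ?_
    simp only [Complex.norm_exp_ofReal_mul_I]
    simp
  have hn2 : ∀ g j, ‖Complex.exp ((-(σ2 / 2 * u g j ^ 2) : ℝ))‖ ≤ 1 := by
    intro g j
    rw [Complex.norm_exp_ofReal, Real.exp_le_one_iff]
    have : 0 ≤ σ2 / 2 * u g j ^ 2 := by positivity
    linarith
  have hp1 : ∀ g, ‖∏ j, ∫ x : ℝ, Complex.exp ((u g j * (x - p) : ℝ) * Complex.I) ∂ν‖ ≤ 1 := by
    intro g
    rw [norm_prod]
    exact Finset.prod_le_one (fun _ _ => norm_nonneg _) fun j _ => hn1 g j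
  have hp2 : ∀ g, ‖∏ j, Complex.exp ((-(σ2 / 2 * u g j ^ 2) : ℝ))‖ ≤ 1 := by
    intro g
    rw [norm_prod]
    exact Finset.prod_le_one (fun _ _ => norm_nonneg _) fun j _ => hn2 g j
  have hi1 := (integrable_const (1 : ℝ) (μ := γ)).mono' hmeas1.aestronglyMeasurable
    (Eventually.of_forall hp1)
  have hi2 := (integrable_const (1 : ℝ) (μ := γ)).mono'
    (by fun_prop : Measurable fun g : ι → ℝ =>
      ∏ j, Complex.exp ((-(σ2 / 2 * u g j ^ 2) : ℝ))).aestronglyMeasurable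
    (Eventually.of_forall hp2)
  rw [← Real.norm_eq_abs, ← Complex.norm_real, Complex.ofReal_sub, hleft, hright,
    ← integral_sub hi1 hi2]
  refine (norm_integral_le_integral_norm _).trans ?_
  refine integral_mono (hi1.sub hi2).norm ?_ fun g => ?_
  · refine (integrable_const (2 : ℝ)).mono' (by fun_prop : Measurable _).aestronglyMeasurable
      (Eventually.of_forall fun g => ?_)
    rw [Real.norm_of_nonneg (by positivity)]
    exact min_le_left _ _
  · refine le_min ((norm_sub_le _ _).trans (by linarith [hp1 g, hp2 g])) ?_
    refine (norm_prod_sub_prod_le _ _ _ (fun j _ => hn1 g j) (fun j _ => hn2 g j)).trans ?_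
    have hu : ∀ j, |u g j| ≤ (∑ m, |g m|) / √N := by
      intro j
      simp only [u]
      rw [abs_div, abs_of_pos hsp]
      gcongr
      refine (Finset.abs_sum_le_sum_abs _ _).trans (Finset.sum_le_sum fun m _ => ?_)
      rw [abs_mul]
      exact mul_le_of_le_one_right (abs_nonneg _) (hc m j)
    calc ∑ j, ‖(∫ x : ℝ, Complex.exp ((u g j * (x - p) : ℝ) * Complex.I) ∂ν)
          - Complex.exp ((-(σ2 / 2 * u g j ^ 2) : ℝ))‖
        ≤ ∑ _j : J, 2 * ((∑ m, |g m|) / √N) ^ 3 := by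
          refine Finset.sum_le_sum fun j _ =>
            (norm_integral_cexp_bernoulli_sub_le p (u g j)).trans ?_
          have := hu j
          gcongr
      _ = 2 * (∑ m, |g m|) ^ 3 / √N := by
          rw [Finset.sum_const, Finset.card_univ, nsmul_eq_mul, ← hN]
          nth_rewrite 1 [← hsqrt]
          field_simp

/-! ### Empirical Laplace transform of the centred power spectrum -/

/-- The normalised power `|λ_k|² / N` at frequency `k` of the vector `x` centred at `p`. -/
noncomputable def centredPower {N : ℕ} [NeZero N] (p : ℝ) (x : ZMod N → ℝ) (k : ZMod N) : ℝ :=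
  ‖dftCoeff (fun j => x j - p) k‖ ^ 2 / N

theorem centredPower_nonneg {N : ℕ} [NeZero N] (p : ℝ) (x : ZMod N → ℝ) (k : ZMod N) :
    0 ≤ centredPower p x k := by
  unfold centredPower; positivity

@[fun_prop]
theorem measurable_centredPower {N : ℕ} [NeZero N] (p : ℝ) (k : ZMod N) :
    Measurable fun x : ZMod N → ℝ => centredPower p x k := by
  unfold centredPower dftCoeff; fun_prop

theorem sum_centredPower_le {N : ℕ} [NeZero N] {p : ℝ} (hp : p ∈ unitInterval) {x : ZMod N → ℝ}
    (hx : ∀ j, x j ∈ unitInterval) : ∑ k, centredPower p x k ≤ N := by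
  have hN : (0 : ℝ) < N := by exact_mod_cast NeZero.pos N
  simp only [centredPower]
  rw [← Finset.sum_div, sum_norm_dftCoeff_sq, mul_div_cancel_left₀ _ hN.ne']
  calc ∑ j, (x j - p) ^ 2 ≤ ∑ _j : ZMod N, (1 : ℝ) := by
        refine Finset.sum_le_sum fun j _ => ?_
        have h1 := (hx j).1; have h2 := (hx j).2; have h3 := hp.1; have h4 := hp.2
        nlinarith
    _ = N := by simp

/-- The joint Laplace transform of the centred powers at generic frequencies is close to that of
independent exponential variables of mean `p (1 - p)`, uniformly in the frequencies. -/
theorem abs_integral_exp_neg_sum_centredPower_sub_le {N : ℕ} [NeZero N] {ι : Type*} [Fintype ι]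
    (p : unitInterval) (s : NNReal) (k : ι → ZMod N) (hk : Function.Injective k)
    (hk' : ∀ m m', k m + k m' ≠ 0) :
    |(∫ x : ZMod N → ℝ, Real.exp (-(s * ∑ m, centredPower p x (k m)))
        ∂Measure.pi fun _ => bernoulliMeasure (1 : ℝ) 0 p)
      - ((1 + p * (1 - p) * s)⁻¹ : ℝ) ^ Fintype.card ι| ≤ cltError (ι ⊕ ι) (2 * s) N := by
  let c : ι ⊕ ι → ZMod N → ℝ := Sum.elim (fun m j => (ZMod.stdAddChar (j * k m)).re)
    (fun m j => (ZMod.stdAddChar (j * k m)).im)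
  have hc : ∀ m j, |c m j| ≤ 1 := by
    rintro (m | m) j
    · exact (Complex.abs_re_le_norm _).trans (norm_stdAddChar _).le
    · exact (Complex.abs_im_le_norm _).trans (norm_stdAddChar _).le
  have h := abs_integral_exp_neg_sub_le p (2 * s) c hc (by
    intro g
    have := sum_sq_trig_eq k hk hk' (fun m => g (Sum.inl m)) (fun m => g (Sum.inr m))
    simp only [Fintype.sum_sum_type, c, Sum.elim_inl, Sum.elim_inr, ← Finset.sum_add_distrib,
      ZMod.card]
    exact this)
  rw [Fintype.card_sum, ← two_mul, pow_mul, integral_exp_neg_mul_sq_gaussianReal_sq _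
    (div_nonneg (mul_nonneg p.2.1 (sub_nonneg.2 p.2.2)) two_pos.le), ZMod.card] at h
  have h1 : (p : ℝ) * (1 - p) / 2 * ((2 * s : NNReal) : ℝ) = p * (1 - p) * s := by
    push_cast; ring
  have h2 : ((2 * s : NNReal) : ℝ) / 2 = s := by push_cast; ring
  rw [h1, h2] at h
  have h3 : ∀ x : ZMod N → ℝ, ∑ m, (∑ j, (x j - p) * c m j) ^ 2 / (N : ℝ)
      = ∑ m, centredPower p x (k m) := by
    intro x
    simp only [Fintype.sum_sum_type, c, Sum.elim_inl, Sum.elim_inr, ← Finset.sum_add_distrib]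
    refine Finset.sum_congr rfl fun m _ => ?_
    rw [centredPower, ← Complex.normSq_eq_norm_sq, Complex.normSq_apply, dftCoeff, Complex.re_sum,
      Complex.im_sum]
    simp only [Complex.re_ofReal_mul, Complex.im_ofReal_mul]
    ring
  simpa only [h3] using h

/-- The Laplace transform at `s` of the empirical measure of the centred powers of `x`. -/
noncomputable def empiricalLaplace {N : ℕ} [NeZero N] (p s : ℝ) (x : ZMod N → ℝ) : ℝ :=
  (∑ k, Real.exp (-(s * centredPower p x k))) / N

theorem empiricalLaplace_mem {N : ℕ} [NeZero N] {p s : ℝ} (hs : 0 ≤ s) (x : ZMod N → ℝ) :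
    empiricalLaplace p s x ∈ unitInterval := by
  have hN : (0 : ℝ) < N := by exact_mod_cast NeZero.pos N
  refine ⟨by unfold empiricalLaplace; positivity, ?_⟩
  rw [empiricalLaplace, div_le_one hN]
  calc _ ≤ ∑ _k : ZMod N, (1 : ℝ) := Finset.sum_le_sum fun k _ => by
        rw [Real.exp_le_one_iff]
        have := mul_nonneg hs (centredPower_nonneg p x k)
        linarith
    _ = N := by simp

/-- Second moment bound: generic pairs of frequencies are nearly uncorrelated, and the remaining
pairs, at most `6 N` of `N²`, contribute at most `1` each. -/
theorem integral_sq_empiricalLaplace_sub_le {N : ℕ} [NeZero N] (p : unitInterval) (s : NNReal) :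
    ∫ x : ZMod N → ℝ, (empiricalLaplace p s x - (1 + p * (1 - p) * s : ℝ)⁻¹) ^ 2
        ∂(Measure.pi fun _ => bernoulliMeasure (1 : ℝ) 0 p)
      ≤ cltError (Fin 2 ⊕ Fin 2) (2 * s) N + 2 * cltError (Unit ⊕ Unit) (2 * s) N + 6 / N := by
  classical
  have hN : (0 : ℝ) < N := by exact_mod_cast NeZero.pos N
  set μ := Measure.pi fun _ : ZMod N => bernoulliMeasure (1 : ℝ) 0 p
  set L : ℝ := (1 + p * (1 - p) * s)⁻¹ with hL
  set ε₂ := cltError (Fin 2 ⊕ Fin 2) (2 * s) N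
  set ε₁ := cltError (Unit ⊕ Unit) (2 * s) N
  have hv : (0 : ℝ) ≤ p * (1 - p) * s := by
    have := mul_nonneg p.2.1 (sub_nonneg.2 p.2.2)
    positivity
  have hL0 : 0 ≤ L := by positivity
  have hL1 : L ≤ 1 := inv_le_one_of_one_le₀ (by linarith)
  let e : ZMod N → (ZMod N → ℝ) → ℝ := fun k x => Real.exp (-(s * centredPower p x k))
  have he0 : ∀ k x, 0 ≤ e k x := fun k x => Real.exp_nonneg _
  have he1 : ∀ k x, e k x ≤ 1 := fun k x => by
    simp only [e]
    rw [Real.exp_le_one_iff]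
    have := mul_nonneg s.coe_nonneg (centredPower_nonneg p x k)
    linarith
  have hemeas : ∀ k, Measurable (e k) := fun k => by simp only [e]; fun_prop
  have hei : ∀ k, Integrable (e k) μ := fun k => (integrable_const (1 : ℝ)).mono'
    (hemeas k).aestronglyMeasurable (Eventually.of_forall fun x => by
      rw [Real.norm_of_nonneg (he0 k x)]; exact he1 k x)
  have heei : ∀ k l, Integrable (fun x => e k x * e l x) μ := fun k l =>
    (integrable_const (1 : ℝ)).mono' ((hemeas k).mul (hemeas l)).aestronglyMeasurable
      (Eventually.of_forall fun x => by
        rw [Real.norm_of_nonneg (mul_nonneg (he0 k x) (he0 l x))]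
        exact mul_le_one₀ (he1 k x) (he0 l x) (he1 l x))
  have hexp : ∀ k l x, (e k x - L) * (e l x - L) = e k x * e l x - L * e k x - L * e l x + L ^ 2 :=
    fun k l x => by ring
  have hprodi : ∀ k l, Integrable (fun x => (e k x - L) * (e l x - L)) μ := fun k l => by
    simp only [hexp]
    exact (((heei k l).sub ((hei k).const_mul L)).sub ((hei l).const_mul L)).add
      (integrable_const _)
  have hε₁ : 0 ≤ ε₁ := integral_nonneg fun g => by positivity
  have hε₂ : 0 ≤ ε₂ := integral_nonneg fun g => by positivity
  have hone : ∀ k : ZMod N, k + k ≠ 0 → |(∫ x, e k x ∂μ) - L| ≤ ε₁ := fun k hk => by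
    have h := abs_integral_exp_neg_sum_centredPower_sub_le p s (fun _ : Unit => k)
      (fun _ _ _ => rfl) (fun _ _ => hk)
    simpa [e] using h
  have hpair : ∀ k l : ZMod N, GenericPair k l →
      ∫ x, (e k x - L) * (e l x - L) ∂μ ≤ ε₂ + 2 * ε₁ := by
    rintro k l ⟨hk, hl, hkl, hne⟩
    have h := abs_integral_exp_neg_sum_centredPower_sub_le p s ![k, l]
      (by
        intro i j
        fin_cases i <;> fin_cases j <;> simp [hne, hne.symm])
      (by
        intro i j
        fin_cases i <;> fin_cases j <;> simp [hk, hl, hkl, add_comm l k])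
    simp only [Fin.sum_univ_two, Matrix.cons_val_zero, Matrix.cons_val_one, mul_add, neg_add,
      Real.exp_add, Fintype.card_fin] at h
    have hk1 := abs_le.1 (hone k hk)
    have hl1 := abs_le.1 (hone l hl)
    have h2 := abs_le.1 h
    simp only [hexp]
    have hi₁ : Integrable (fun x => e k x * e l x - L * e k x) μ :=
      (heei k l).sub ((hei k).const_mul L)
    have hi₂ : Integrable (fun x => e k x * e l x - L * e k x - L * e l x) μ :=
      hi₁.sub ((hei l).const_mul L)
    rw [integral_add hi₂ (integrable_const _), integral_sub hi₁ ((hei l).const_mul L),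
      integral_sub (heei k l) ((hei k).const_mul L), integral_const_mul, integral_const_mul]
    simp only [integral_const, probReal_univ, one_smul]
    have a1 : L * (L - ∫ x, e k x ∂μ) ≤ ε₁ :=
      (mul_le_mul_of_nonneg_left (by linarith : L - ∫ x, e k x ∂μ ≤ ε₁) hL0).trans
        (mul_le_of_le_one_left hε₁ hL1)
    have a2 : L * (L - ∫ x, e l x ∂μ) ≤ ε₁ :=
      (mul_le_mul_of_nonneg_left (by linarith : L - ∫ x, e l x ∂μ ≤ ε₁) hL0).trans
        (mul_le_of_le_one_left hε₁ hL1)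
    have a3 : ∫ x, e k x * e l x ∂μ ≤ L ^ 2 + ε₂ := by
      have := h2.2
      simp only [e]
      linarith
    linarith
  have htriv : ∀ k l : ZMod N, ∫ x, (e k x - L) * (e l x - L) ∂μ ≤ 1 := by
    intro k l
    calc ∫ x, (e k x - L) * (e l x - L) ∂μ ≤ ∫ _x, (1 : ℝ) ∂μ := by
          refine integral_mono (hprodi k l) (integrable_const _) fun x => ?_
          have h1 : |e k x - L| ≤ 1 := abs_le.2 ⟨by linarith [he0 k x], by linarith [he1 k x]⟩
          have h2 : |e l x - L| ≤ 1 := abs_le.2 ⟨by linarith [he0 l x], by linarith [he1 l x]⟩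
          refine (le_abs_self _).trans ?_
          rw [abs_mul]
          exact mul_le_one₀ h1 (abs_nonneg _) h2
      _ = 1 := by simp
  have hS : ∀ x, (empiricalLaplace p s x - L) ^ 2
      = (∑ z : ZMod N × ZMod N, (e z.1 x - L) * (e z.2 x - L)) / N ^ 2 := by
    intro x
    have h1 : empiricalLaplace p s x - L = (∑ k, (e k x - L)) / N := by
      rw [Finset.sum_sub_distrib, empiricalLaplace, Finset.sum_const, Finset.card_univ, ZMod.card,
        nsmul_eq_mul]
      simp only [e]
      field_simp
    rw [h1, div_pow, pow_two (∑ k, _), Finset.sum_mul_sum, Fintype.sum_prod_type]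
  simp only [hS]
  rw [integral_div, integral_finsetSum _ fun z _ => hprodi z.1 z.2, div_le_iff₀ (by positivity)]
  have hterm : ∀ z : ZMod N × ZMod N, ∫ x, (e z.1 x - L) * (e z.2 x - L) ∂μ
      ≤ (ε₂ + 2 * ε₁) + if ¬ GenericPair z.1 z.2 then 1 else 0 := by
    intro z
    by_cases hz : GenericPair z.1 z.2
    · simpa [hz] using hpair _ _ hz
    · simp only [hz, not_false_eq_true, if_true]
      linarith [htriv z.1 z.2]
  refine (Finset.sum_le_sum fun z _ => hterm z).trans ?_
  rw [Finset.sum_add_distrib, Finset.sum_const, Finset.card_univ, Fintype.card_prod, ZMod.card,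
    Finset.sum_boole, nsmul_eq_mul]
  have hcard : ((Finset.univ.filter fun z : ZMod N × ZMod N => ¬ GenericPair z.1 z.2).card : ℝ)
      ≤ 6 * N := by
    have := card_not_genericPair_le N
    convert (Nat.cast_le (α := ℝ)).2 this
    · rfl
    · push_cast; rfl
  push_cast
  have : (ε₂ + 2 * ε₁ + 6 / N) * (N : ℝ) ^ 2 = N * N * (ε₂ + 2 * ε₁) + 6 * N := by
    field_simp
  linarith

theorem tendsto_lintegral_enorm_empiricalLaplace_sub (p : unitInterval) (s : NNReal) :
    Tendsto (fun n : ℕ => ∫⁻ x : ZMod (n + 1) → ℝ,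
      ‖empiricalLaplace p s x - (1 + p * (1 - p) * s : ℝ)⁻¹‖ₑ
        ∂Measure.pi fun _ => bernoulliMeasure (1 : ℝ) 0 p) atTop (𝓝 0) := by
  let B : ℕ → ℝ := fun N => cltError (Fin 2 ⊕ Fin 2) (2 * s) N
    + 2 * cltError (Unit ⊕ Unit) (2 * s) N + 6 / N
  have hB : Tendsto B atTop (𝓝 0) := by
    have h := ((tendsto_cltError (Fin 2 ⊕ Fin 2) (2 * s)).add
      ((tendsto_cltError (Unit ⊕ Unit) (2 * s)).const_mul 2)).add
      (tendsto_const_div_atTop_nhds_zero_nat (6 : ℝ))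
    simpa using h
  have hB' : Tendsto (fun n : ℕ => ENNReal.ofReal √(B (n + 1))) atTop (𝓝 0) := by
    have h := ENNReal.tendsto_ofReal
      ((Real.continuous_sqrt.tendsto 0).comp (hB.comp (tendsto_add_atTop_nat 1)))
    simpa using h
  refine tendsto_of_tendsto_of_tendsto_of_le_of_le tendsto_const_nhds hB' (fun _ => zero_le) ?_
  intro n
  set L : ℝ := (1 + p * (1 - p) * s)⁻¹ with hL
  set μ := Measure.pi fun _ : ZMod (n + 1) => bernoulliMeasure (1 : ℝ) 0 p
  let f : (ZMod (n + 1) → ℝ) → ℝ := fun x => empiricalLaplace p s x - L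
  have hfm : Measurable f := by simp only [f, empiricalLaplace]; fun_prop
  have hfb : ∀ x, ‖f x‖ ≤ 1 + |L| := fun x => by
    have h := empiricalLaplace_mem (p := p) s.coe_nonneg x
    refine (norm_sub_le _ _).trans ?_
    rw [Real.norm_eq_abs, Real.norm_eq_abs, abs_of_nonneg h.1]
    linarith [h.2]
  have hfi : Integrable f μ := (integrable_const (1 + |L|)).mono' hfm.aestronglyMeasurable
    (Eventually.of_forall hfb)
  have hfi2 : Integrable (fun x => |f x| ^ 2) μ :=
    (integrable_const ((1 + |L|) ^ 2)).mono' (by fun_prop : Measurable _).aestronglyMeasurable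
      (Eventually.of_forall fun x => by
        rw [Real.norm_of_nonneg (by positivity)]
        exact pow_le_pow_left₀ (abs_nonneg _) (hfb x) 2)
  have hJ : (∫ x, |f x| ∂μ) ^ 2 ≤ ∫ x, |f x| ^ 2 ∂μ :=
    (even_two.convexOn_pow (𝕜 := ℝ)).map_integral_le (continuous_pow 2).continuousOn isClosed_univ
      (Eventually.of_forall fun _ => Set.mem_univ _) hfi.abs hfi2
  simp only [sq_abs] at hJ
  have h1 := integral_sq_empiricalLaplace_sub_le (N := n + 1) p s
  change ∫⁻ x, ‖f x‖ₑ ∂μ ≤ _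
  rw [← ofReal_integral_norm_eq_lintegral_enorm hfi]
  exact ENNReal.ofReal_le_ofReal (Real.le_sqrt_of_sq_le (hJ.trans h1))

theorem ae_mem_unitInterval_bernoulli (p : unitInterval) :
    ∀ᵐ y ∂bernoulliMeasure (1 : ℝ) 0 p, y ∈ unitInterval := by
  rw [ae_iff, show {y : ℝ | ¬ y ∈ unitInterval} = (unitInterval)ᶜ from rfl,
    bernoulliMeasure_apply_of_notMem_of_notMem p measurableSet_Icc.compl] <;> simp

theorem ae_pi_mem_unitInterval {J : Type*} [Fintype J] (p : unitInterval) :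
    ∀ᵐ x ∂Measure.pi fun _ : J => bernoulliMeasure (1 : ℝ) 0 p, ∀ j, x j ∈ unitInterval :=
  ae_all_iff.2 fun j => (Measure.quasiMeasurePreserving_eval
    (fun _ : J => bernoulliMeasure (1 : ℝ) 0 p) j).ae (ae_mem_unitInterval_bernoulli p)

/-- The normalized mutual information with the aperture centred at its mean `p`, where `c` stands for
`1 / (W + p J)`. -/
noncomputable def centredInfo {N : ℕ} [NeZero N] (p c : ℝ) (x : ZMod N → ℝ) : ℝ :=
  (∑ k, Real.log (1 + c * centredPower p x k)) / N

theorem centredInfo_eq_integral {N : ℕ} [NeZero N] (p : ℝ) {c : ℝ} (hc : 0 ≤ c) (x : ZMod N → ℝ) :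
    IntegrableOn (fun t => t⁻¹ * Real.exp (-t) * (1 - empiricalLaplace p (c * t) x)) (Set.Ioi 0) ∧
    centredInfo p c x
      = ∫ t in Set.Ioi (0 : ℝ), t⁻¹ * Real.exp (-t) * (1 - empiricalLaplace p (c * t) x) := by
  have hN : (N : ℝ) ≠ 0 := by exact_mod_cast NeZero.ne N
  have h0 : ∀ k, 0 ≤ c * centredPower p x k := fun k => mul_nonneg hc (centredPower_nonneg p x k)
  have h1 : ∀ t : ℝ, t⁻¹ * Real.exp (-t) * (1 - empiricalLaplace p (c * t) x)
      = (∑ k, t⁻¹ * Real.exp (-t) * (1 - Real.exp (-(c * centredPower p x k * t)))) / N := by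
    intro t
    rw [← Finset.mul_sum, Finset.sum_sub_distrib, empiricalLaplace]
    simp only [Finset.sum_const, Finset.card_univ, ZMod.card, nsmul_eq_mul, mul_one,
      mul_right_comm c _ t]
    field_simp
  simp only [h1]
  have h2 := fun k => integrableOn_frullani (h0 k)
  refine ⟨(integrable_finsetSum _ fun k _ => h2 k).div_const _, ?_⟩
  rw [integral_div, integral_finsetSum _ fun k _ => h2 k, centredInfo]
  simp only [log_one_add_eq_integral (h0 _)]

/-- Convergence in mean of the centred information. -/
theorem tendsto_lintegral_enorm_centredInfo_sub (p : unitInterval) {c : ℝ} (hc : 0 ≤ c) :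
    Tendsto (fun n : ℕ => ∫⁻ x : ZMod (n + 1) → ℝ, ‖centredInfo p c x
      - ∫ t in Set.Ioi (0 : ℝ), t⁻¹ * Real.exp (-t) * (1 - (1 + p * (1 - p) * (c * t) : ℝ)⁻¹)‖ₑ
        ∂Measure.pi fun _ => bernoulliMeasure (1 : ℝ) 0 p) atTop (𝓝 0) := by
  have hv0 : (0 : ℝ) ≤ p * (1 - p) := mul_nonneg p.2.1 (sub_nonneg.2 p.2.2)
  have hv1 : (p : ℝ) * (1 - p) ≤ 1 := by nlinarith [p.2.1, p.2.2]
  let μ : (n : ℕ) → Measure (ZMod (n + 1) → ℝ) := fun n =>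
    Measure.pi fun _ => bernoulliMeasure (1 : ℝ) 0 p
  let L : ℝ → ℝ := fun t => (1 + p * (1 - p) * (c * t))⁻¹
  let D : (n : ℕ) → ℝ → (ZMod (n + 1) → ℝ) → ℝ := fun n t x =>
    t⁻¹ * Real.exp (-t) * (empiricalLaplace p (c * t) x - L t)
  have hL : ∀ t, 0 < t → 0 ≤ 1 - L t ∧ 1 - L t ≤ c * t := by
    intro t ht
    have h1 : 0 ≤ c * t := by positivity
    have h2 : 0 ≤ (p : ℝ) * (1 - p) * (c * t) := by positivity
    have h3 : 1 - L t = p * (1 - p) * (c * t) / (1 + p * (1 - p) * (c * t)) := by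
      simp only [L]; field_simp; ring
    rw [h3]
    refine ⟨by positivity, (div_le_self h2 (by linarith)).trans ?_⟩
    exact mul_le_of_le_one_left h1 hv1
  have hLint : IntegrableOn (fun t => t⁻¹ * Real.exp (-t) * (1 - L t)) (Set.Ioi 0) := by
    refine ((integrableOn_exp_neg_Ioi 0).const_mul c).mono'
      (by fun_prop : Measurable _).aestronglyMeasurable ?_
    filter_upwards [ae_restrict_mem measurableSet_Ioi] with t ht
    have ht : 0 < t := ht
    obtain ⟨h1, h2⟩ := hL t ht
    rw [Real.norm_of_nonneg (by positivity)]
    calc _ ≤ t⁻¹ * Real.exp (-t) * (c * t) := by gcongr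
      _ = c * Real.exp (-t) := by field_simp
  have hDmeas : ∀ n, Measurable (fun z : (ZMod (n + 1) → ℝ) × ℝ => D n z.2 z.1) := by
    intro n
    simp only [D, L, empiricalLaplace, centredPower, dftCoeff]
    fun_prop
  have hle : ∀ n, ∫⁻ x, ‖centredInfo p c x
      - ∫ t in Set.Ioi (0 : ℝ), t⁻¹ * Real.exp (-t) * (1 - L t)‖ₑ ∂μ n
      ≤ ∫⁻ t in Set.Ioi (0 : ℝ), ∫⁻ x, ‖D n t x‖ₑ ∂μ n := by
    intro n
    -- Tonelli, after writing both terms as integrals against `t⁻¹ e⁻ᵗ`.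
    rw [lintegral_lintegral_swap
      (((hDmeas n).comp measurable_swap).enorm.aemeasurable)]
    refine lintegral_mono fun x => ?_
    obtain ⟨h1, h2⟩ := centredInfo_eq_integral p hc x
    rw [h2, ← integral_sub h1 hLint, ← enorm_neg, ← integral_neg]
    refine (enorm_integral_le_lintegral_enorm _).trans (le_of_eq ?_)
    congr 1
    funext t
    congr 1
    simp only [D]
    ring
  have hlim : Tendsto (fun n => ∫⁻ t in Set.Ioi (0 : ℝ), ∫⁻ x, ‖D n t x‖ₑ ∂μ n) atTop
      (𝓝 (∫⁻ t in Set.Ioi (0 : ℝ), 0)) := by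
    refine tendsto_lintegral_of_dominated_convergence'
      (fun t => ENNReal.ofReal (c * Real.exp (-t))) ?_ ?_ ?_ ?_
    · intro n
      exact ((hDmeas n).comp measurable_swap).enorm.lintegral_prod_right'.aemeasurable
    · intro n
      filter_upwards [ae_restrict_mem measurableSet_Ioi] with t ht
      have ht : 0 < t := ht
      calc ∫⁻ x, ‖D n t x‖ₑ ∂μ n ≤ ∫⁻ _x, ENNReal.ofReal (c * Real.exp (-t)) ∂μ n := by
            refine lintegral_mono_ae ?_
            filter_upwards [ae_pi_mem_unitInterval p] with x hx
            rw [← ofReal_norm]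
            refine ENNReal.ofReal_le_ofReal ?_
            have hct : 0 ≤ c * t := by positivity
            have hS := empiricalLaplace_mem (p := p) hct x
            have hS1 : 1 - empiricalLaplace p (c * t) x ≤ c * t := by
              have hN : (0 : ℝ) < (n + 1 : ℕ) := by positivity
              rw [empiricalLaplace, sub_le_iff_le_add, ← sub_le_iff_le_add', le_div_iff₀ hN]
              calc (1 - c * t) * ((n + 1 : ℕ) : ℝ)
                  ≤ ((n + 1 : ℕ) : ℝ) - c * t * ∑ k, centredPower p x k := by
                    have := mul_le_mul_of_nonneg_left (sum_centredPower_le p.2 hx) hct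
                    linarith
                _ = ∑ k : ZMod (n + 1), (1 - c * t * centredPower p x k) := by
                    rw [Finset.sum_sub_distrib, Finset.mul_sum]
                    simp
                _ ≤ _ := Finset.sum_le_sum fun k _ => by
                    have := one_sub_exp_neg_le (c * t * centredPower p x k)
                    linarith
            obtain ⟨h1, h2⟩ := hL t ht
            have habs : |empiricalLaplace p (c * t) x - L t| ≤ c * t :=
              abs_le.2 ⟨by linarith, by linarith [hS.2]⟩
            simp only [D]
            rw [norm_mul, Real.norm_of_nonneg (by positivity), Real.norm_eq_abs]
            calc _ ≤ t⁻¹ * Real.exp (-t) * (c * t) := by gcongr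
              _ = c * Real.exp (-t) := by field_simp
        _ = ENNReal.ofReal (c * Real.exp (-t)) := by simp
    · exact ((integrableOn_exp_neg_Ioi 0).const_mul c).lintegral_lt_top.ne
    · filter_upwards [ae_restrict_mem measurableSet_Ioi] with t ht
      have ht : 0 < t := ht
      have h := tendsto_lintegral_enorm_empiricalLaplace_sub p ⟨c * t, by positivity⟩
      have h2 := ENNReal.Tendsto.const_mul (a := ‖t⁻¹ * Real.exp (-t)‖ₑ) h (Or.inr enorm_ne_top)
      rw [mul_zero] at h2
      refine h2.congr fun n => ?_
      rw [← lintegral_const_mul' _ _ enorm_ne_top]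
      simp only [D, enorm_mul]
      rfl
  rw [lintegral_zero] at hlim
  exact tendsto_of_tendsto_of_tendsto_of_le_of_le tendsto_const_nhds hlim
    (fun _ => zero_le) hle

/-! ### The mutual information of the circulant aperture -/
theorem normalizedMutualInfo_transferMatrix (W J ρ : ℝ) (n : ℕ) (h : 0 ≤ 1 / (W + ρ * J))
    (x : Fin (n + 1) → ℝ) :
    normalizedMutualInfo W J ρ (transferMatrix x) (iidSceneCov (n + 1))
      = (∑ k : ZMod (n + 1), Real.log (1 + 1 / (W + ρ * J) *
          (‖dftCoeff (N := n + 1) x k‖ ^ 2 / (n + 1 : ℕ)))) / (n + 1 : ℕ) := by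
  have hdet := det_smul_circulant_mul_transpose_add_one (N := n + 1) x
    (1 / (W + ρ * J) * (1 / (n + 1 : ℕ)))
  have hM : ((1 / (W + ρ * J)) • ((1 / ((n + 1 : ℕ) : ℝ)) •
      (transferMatrix x * iidSceneCov (n + 1) * (transferMatrix x)ᵀ)) + 1).det
      = ∏ k : ZMod (n + 1),
        (1 + 1 / (W + ρ * J) * (1 / (n + 1 : ℕ)) * ‖dftCoeff (N := n + 1) x k‖ ^ 2) := by
    rw [← hdet, iidSceneCov, mul_one, smul_smul]
    rfl
  rw [normalizedMutualInfo, mutualInfo, hM, Real.log_prod]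
  · congr 1
    refine Finset.sum_congr rfl fun k _ => ?_
    congr 2
    ring
  · intro k _
    positivity

/-- Constant vectors have no Fourier coefficient away from the frequency `0`. -/
theorem dftCoeff_sub_const {N : ℕ} [NeZero N] (p : ℝ) (x : ZMod N → ℝ) {k : ZMod N} (hk : k ≠ 0) :
    dftCoeff (fun j => x j - p) k = dftCoeff x k := by
  simp only [dftCoeff, Complex.ofReal_sub, sub_mul, Finset.sum_sub_distrib, ← Finset.mul_sum,
    sum_stdAddChar_mul, if_neg hk, mul_zero, sub_zero]

theorem norm_dftCoeff_le {N : ℕ} [NeZero N] {y : ZMod N → ℝ} (hy : ∀ j, |y j| ≤ 1) (k : ZMod N) :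
    ‖dftCoeff y k‖ ≤ N := by
  calc ‖dftCoeff y k‖ ≤ ∑ j, ‖(y j : ℂ) * ZMod.stdAddChar (j * k)‖ := norm_sum_le _ _
    _ ≤ ∑ _j : ZMod N, (1 : ℝ) := Finset.sum_le_sum fun j _ => by
        rw [norm_mul, norm_stdAddChar, mul_one, Complex.norm_real]
        exact hy j
    _ = N := by simp

/-- Centring affects only the frequency `0`, where both terms lie between `0` and `log (1 + c N)`. -/
theorem abs_sum_log_sub_centredInfo_le {N : ℕ} [NeZero N] {p c : ℝ} (hp : p ∈ unitInterval)
    (hc : 0 ≤ c) {x : ZMod N → ℝ} (hx : ∀ j, x j ∈ unitInterval) :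
    |(∑ k, Real.log (1 + c * (‖dftCoeff x k‖ ^ 2 / N))) / N - centredInfo p c x|
      ≤ Real.log (1 + c * N) / N := by
  have hN : (0 : ℝ) < N := by exact_mod_cast NeZero.pos N
  have hlog : ∀ y : ZMod N → ℝ, (∀ j, |y j| ≤ 1) →
      0 ≤ Real.log (1 + c * (‖dftCoeff y 0‖ ^ 2 / N)) ∧
      Real.log (1 + c * (‖dftCoeff y 0‖ ^ 2 / N)) ≤ Real.log (1 + c * N) := by
    intro y hy
    have h0 : 0 ≤ c * (‖dftCoeff y 0‖ ^ 2 / N) := by positivity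
    refine ⟨Real.log_nonneg (by linarith), Real.log_le_log (by linarith) ?_⟩
    have h1 : ‖dftCoeff y 0‖ ^ 2 / N ≤ N := by
      rw [div_le_iff₀ hN, ← pow_two]
      exact pow_le_pow_left₀ (norm_nonneg _) (norm_dftCoeff_le hy 0) 2
    gcongr
  rw [centredInfo, ← sub_div, ← Finset.sum_sub_distrib, Finset.sum_eq_single 0, abs_div,
    abs_of_pos hN]
  · gcongr
    obtain ⟨h1, h2⟩ := hlog x fun j => abs_le.2 ⟨by linarith [(hx j).1], (hx j).2⟩
    obtain ⟨h3, h4⟩ := hlog (fun j => x j - p) fun j =>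
      abs_le.2 ⟨by linarith [(hx j).1, hp.2], by linarith [(hx j).2, hp.1]⟩
    rw [centredPower]
    exact abs_le.2 ⟨by linarith, by linarith⟩
  · intro k _ hk
    rw [centredPower, dftCoeff_sub_const p x hk, sub_self]
  · simp

theorem tendsto_log_one_add_mul_div (c : ℝ) (hc : 0 ≤ c) :
    Tendsto (fun n : ℕ => Real.log (1 + c * n) / n) atTop (𝓝 0) := by
  rcases hc.eq_or_lt with rfl | hc
  · simp
  have h1 : Tendsto (fun n : ℕ => 1 + c * (n : ℝ)) atTop atTop :=
    tendsto_atTop_add_const_left _ _ (tendsto_natCast_atTop_atTop.const_mul_atTop hc)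
  have h2 := (Real.isLittleO_log_id_atTop.comp_tendsto h1)
  have h3 : (fun n : ℕ => 1 + c * (n : ℝ)) =O[atTop] fun n : ℕ => (n : ℝ) := by
    refine Asymptotics.IsBigO.of_bound (1 + c) ?_
    filter_upwards [eventually_ge_atTop 1] with n hn
    have : (1 : ℝ) ≤ n := by exact_mod_cast hn
    rw [Real.norm_of_nonneg (by positivity), Real.norm_of_nonneg (by positivity)]
    nlinarith
  exact (h2.trans_isBigO h3).tendsto_div_nhds_zero

end CodedAperture

open CodedAperture in
theorem proposition2 (W J p : ℝ) (hp0 : 0 < p) (hp1 : p < 1) (hWJ : 0 < W + p * J)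
    {Ω : Type*} [MeasurableSpace Ω] (P : Measure Ω) [IsProbabilityMeasure P]
    (a : (n : ℕ) → Fin n → Ω → ℝ)
    (hindep : ∀ n, iIndepFun (a n) P)
    (hlaw : ∀ n i, HasLaw (a n i) (bernoulliMeasure (1 : ℝ) (0 : ℝ) ⟨p, hp0.le, hp1.le⟩) P)
    {Ω' : Type*} [MeasurableSpace Ω'] (P' : Measure Ω') [IsProbabilityMeasure P']
    (X : Ω' → ℝ) (hX : HasLaw X CodedAperture.limitSpectralLaw P') :
    Integrable (fun ω' => Real.log (p * (1 - p) / (W + p * J) * X ω' ^ 2 + 1)) P' ∧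
    TendstoInMeasure P
      (fun (n : ℕ) (ω : Ω) => CodedAperture.normalizedMutualInfo W J p
        (CodedAperture.transferMatrix fun i => a n i ω) (CodedAperture.iidSceneCov n))
      atTop
      (fun _ => ∫ ω', Real.log (p * (1 - p) / (W + p * J) * X ω' ^ 2 + 1) ∂P') := by
  set q : unitInterval := ⟨p, hp0.le, hp1.le⟩ with hq
  set c : ℝ := 1 / (W + p * J) with hc
  have hc0 : 0 ≤ c := by positivity
  have hb0 : 0 ≤ c * (p * (1 - p)) := mul_nonneg hc0 (mul_nonneg hp0.le (by linarith))
  have hform : ∀ y : ℝ, Real.log (p * (1 - p) / (W + p * J) * y ^ 2 + 1)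
      = Real.log (1 + c * (p * (1 - p)) * y ^ 2) := by
    intro y
    rw [hc]
    congr 1
    ring
  simp only [hform]
  have hmeas : Measurable fun y : ℝ => Real.log (1 + c * (p * (1 - p)) * y ^ 2) := by fun_prop
  have hprob : IsProbabilityMeasure limitSpectralLaw := hX.isProbabilityMeasure_iff.1 inferInstance
  refine ⟨?_, ?_⟩
  · have h := integrable_log_limitSpectralLaw hb0
    rw [← hX.map_eq] at h
    exact h.comp_aemeasurable hX.aemeasurable
  · have hint : ∫ ω', Real.log (1 + c * (p * (1 - p)) * X ω' ^ 2) ∂P'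
        = ∫ t in Set.Ioi (0 : ℝ), t⁻¹ * Real.exp (-t) * (1 - (1 + q * (1 - q) * (c * t) : ℝ)⁻¹) := by
      have h1 := hX.integral_comp hmeas.aestronglyMeasurable
      refine h1.trans ((integral_log_limitSpectralLaw hb0).trans ?_)
      refine integral_congr_ae (Eventually.of_forall fun t => ?_)
      simp only [hq]
      ring_nf
    rw [hint]
    set l := ∫ t in Set.Ioi (0 : ℝ), t⁻¹ * Real.exp (-t) * (1 - (1 + q * (1 - q) * (c * t) : ℝ)⁻¹)
    have hvec : ∀ n : ℕ, HasLaw (fun ω (i : ZMod (n + 1)) => a (n + 1) i ω)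
        (Measure.pi fun _ : ZMod (n + 1) => bernoulliMeasure (1 : ℝ) 0 q) P := fun n =>
      iIndepFun.hasLaw_pi (hlaw (n + 1)) (hindep (n + 1))
    have hL1 := tendsto_lintegral_enorm_centredInfo_sub q hc0
    rw [tendstoInMeasure_iff_norm]
    intro ε hε
    -- Work with `n + 1`, for which `Fin (n + 1)` is `ZMod (n + 1)` by definition.
    rw [← tendsto_add_atTop_iff_nat 1]
    have hlogsmall : ∀ᶠ n : ℕ in atTop, Real.log (1 + c * (n + 1 : ℕ)) / (n + 1 : ℕ) < ε / 2 :=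
      ((tendsto_log_one_add_mul_div c hc0).comp (tendsto_add_atTop_nat 1)).eventually
        (gt_mem_nhds (by positivity))
    have hε2 : ENNReal.ofReal (ε / 2) ≠ 0 := (ENNReal.ofReal_pos.2 (by positivity)).ne'
    have hup := ENNReal.Tendsto.div_const (b := ENNReal.ofReal (ε / 2)) hL1 (Or.inr hε2)
    rw [ENNReal.zero_div] at hup
    refine tendsto_of_tendsto_of_tendsto_of_le_of_le' tendsto_const_nhds hup
      (Eventually.of_forall fun _ => zero_le) ?_
    filter_upwards [hlogsmall] with n hn
    have hfm : Measurable fun x : ZMod (n + 1) → ℝ => ‖centredInfo q c x - l‖ₑ := by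
      simp only [centredInfo]; fun_prop
    refine le_trans ?_ (meas_ge_le_lintegral_div hfm.aemeasurable hε2 ENNReal.ofReal_ne_top)
    rw [← (hvec n).measure_eq (measurableSet_le measurable_const hfm)]
    refine measure_mono_ae ?_
    have hae := ae_pi_mem_unitInterval (J := ZMod (n + 1)) q
    rw [← (hvec n).map_eq] at hae
    filter_upwards [ae_of_ae_map (hvec n).aemeasurable hae] with ω hω hωε
    have hωε : ε ≤ ‖normalizedMutualInfo W J p (transferMatrix fun i => a (n + 1) i ω)
      (iidSceneCov (n + 1)) - l‖ := hωε
    change ENNReal.ofReal (ε / 2) ≤ ‖centredInfo q c (fun i : ZMod (n + 1) => a (n + 1) i ω) - l‖ₑ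
    rw [normalizedMutualInfo_transferMatrix W J p n hc0] at hωε
    have hd := abs_sum_log_sub_centredInfo_le q.2 hc0 hω
    rw [← ofReal_norm]
    refine ENNReal.ofReal_le_ofReal ?_
    have htri := norm_sub_le_norm_sub_add_norm_sub
      ((∑ k : ZMod (n + 1), Real.log (1 + 1 / (W + p * J) *
          (‖dftCoeff (N := n + 1) (fun i => a (n + 1) i ω) k‖ ^ 2 / (n + 1 : ℕ)))) / (n + 1 : ℕ))
      (centredInfo q c (fun i : ZMod (n + 1) => a (n + 1) i ω)) l
    have hsum := (hωε.trans htri).trans (add_le_add_left hd _)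
    linarith
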